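/- Let $\alpha>0$ and, for $t>0$, let $w(x,t)=(1-x^2)^{\alpha}e^{-t/x^2}$ on $[-1,1]$. Let $P_n(x,t)$ ($n=0,1,2,\dots$) be the monic polynomials in $x$ of degree $n$ that are orthogonal with respect to $w(\cdot,t)$: $$\int_{-1}^{1}P_j(x,t)P_k(x,t)w(x,t)\,dx=h_j(t)\,\delta_{jk}.$$ Put $$R_n(t)=\frac{2t}{h_n(t)}\int_{-1}^{1}\frac{P_n^2(y,t)\,w(y,t)}{y^2}\,dy\quad(n\ge 0),$$ $$r_n(t)=\frac{2t}{h_{n-1}(t)}\int_{-1}^{1}\frac{P_n(y,t)P_{n-1}(y,t)\,w(y,t)}{y^3}\,dy\quad(n\ge 1),\qquad r_0(t)=0.$$ Then for every integer $n\ge 0$ and every $t>0$ the functions $r_n$ and $R_n$ are differentiable at $t$, the numbers $R_n(t)$ and $2n+1+2\alpha+R_n(t)$ are nonzero, and $r_n$, $R_n$ satisfy the coupled Riccati equations $$2t\,r_n'(t)=-\frac{2(-1)^n t\,r_n(t)\,\bigl(2n+1+2\alpha+R_n(t)\bigr)}{R_n(t)}-\frac{(n+r_n(t))(n+2\alpha+r_n(t))R_n(t)}{2n+1+2\alpha+R_n(t)},$$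 $$2t\,R_n'(t)=R_n^2(t)+\bigl[1-2(-1)^n t-2r_n(t)\bigr]R_n(t)-2(-1)^n(2n+2\alpha+1)\,t.$$ -/

import Mathlib

open Polynomial

noncomputable section

namespace SingularJacobi

/-- The singularly perturbed Jacobi weight `w(x,t) = (1 - x²)^α exp(-t/x²)` on `[-1,1]`.
(At the single point `x = 0` the formula evaluates to `1`, because `-t / 0 = 0`; this does not
affect any of the integrals below.) -/
def weight (α t x : ℝ) : ℝ := (1 - x ^ 2) ^ α * Real.exp (-t / x ^ 2)

/-- The bilinear form `⟨p, q⟩ = ∫_{-1}^{1} p(x) q(x) w(x,t) dx`. -/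
def form (α t : ℝ) (p q : ℝ[X]) : ℝ :=
  ∫ x in (-1 : ℝ)..1, p.eval x * q.eval x * weight α t x

/-- The monic orthogonal polynomials `P_n(x,t)` for the weight `w(·,t)`, by the Gram-Schmidt process
applied to `1, X, X², …`. -/
def P (α t : ℝ) (n : ℕ) : ℝ[X] :=
  X ^ n - ∑ k : Fin n,
    C (form α t (X ^ n) (P α t k) / form α t (P α t k) (P α t k)) * P α t k
termination_by n
decreasing_by all_goals exact k.2

/-- The squared norms `h_n(t) = ∫_{-1}^{1} P_n(x,t)² w(x,t) dx`. -/
def h (α : ℝ) (n : ℕ) (t : ℝ) : ℝ :=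
  ∫ x in (-1 : ℝ)..1, (P α t n).eval x ^ 2 * weight α t x

/-- `R_n(t) = (2t / h_n) ∫_{-1}^{1} P_n(y)² w(y) / y² dy`. -/
def R (α : ℝ) (n : ℕ) (t : ℝ) : ℝ :=
  2 * t / h α n t * ∫ y in (-1 : ℝ)..1, (P α t n).eval y ^ 2 * weight α t y / y ^ 2

/-- `r_n(t) = (2t / h_{n-1}) ∫_{-1}^{1} P_n(y) P_{n-1}(y) w(y) / y³ dy` for `n ≥ 1`,
and `r_0(t) = 0`. -/
def r (α : ℝ) (n : ℕ) (t : ℝ) : ℝ :=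
  match n with
  | 0 => 0
  | m + 1 => 2 * t / h α m t *
      ∫ y in (-1 : ℝ)..1,
        (P α t (m + 1)).eval y * (P α t m).eval y * weight α t y / y ^ 3

theorem weight_nonneg (α t : ℝ) {x : ℝ} (hx : x ∈ Set.Icc (-1 : ℝ) 1) : 0 ≤ weight α t x :=
  mul_nonneg (Real.rpow_nonneg (by nlinarith [hx.1, hx.2]) _) (Real.exp_pos _).le

theorem weight_le_one {α t x : ℝ} (hα : 0 < α) (ht : 0 ≤ t) (hx : x ∈ Set.Icc (-1 : ℝ) 1) :
    weight α t x ≤ 1 := by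
  unfold weight
  have h1 : (1 - x ^ 2) ^ α ≤ 1 :=
    Real.rpow_le_one (by nlinarith [hx.1, hx.2]) (by nlinarith) hα.le
  have h2 : Real.exp (-t / x ^ 2) ≤ 1 := by
    rw [Real.exp_le_one_iff]
    exact div_nonpos_of_nonpos_of_nonneg (by linarith) (sq_nonneg x)
  exact mul_le_one₀ h1 (Real.exp_pos _).le h2

theorem integrable_mul_weight {α t : ℝ} (hα : 0 < α) (ht : 0 ≤ t) (p : ℝ[X]) :
    IntervalIntegrable (fun x => p.eval x * weight α t x) MeasureTheory.volume (-1) 1 := by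
  have hp : IntervalIntegrable (fun x => p.eval x) MeasureTheory.volume (-1) 1 :=
    p.continuous.intervalIntegrable _ _
  rw [intervalIntegrable_iff_integrableOn_Icc_of_le (by norm_num)] at hp ⊢
  have hm : Measurable (weight α t) := by unfold weight; fun_prop
  refine hp.mul_bdd (c := 1) hm.aestronglyMeasurable ?_
  filter_upwards [MeasureTheory.ae_restrict_mem measurableSet_Icc] with x hx
  rw [Real.norm_of_nonneg (weight_nonneg α t hx)]
  exact weight_le_one hα ht hx

theorem form_comm (α t : ℝ) (p q : ℝ[X]) : form α t p q = form α t q p := by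
  simp only [form, mul_comm (eval _ p)]

theorem form_sub_left {α t : ℝ} (hα : 0 < α) (ht : 0 ≤ t) (p q s : ℝ[X]) :
    form α t (p - q) s = form α t p s - form α t q s := by
  unfold form
  have h1 := integrable_mul_weight hα ht (p * s)
  have h2 := integrable_mul_weight hα ht (q * s)
  simp only [eval_mul] at h1 h2
  rw [← intervalIntegral.integral_sub h1 h2]
  simp only [eval_sub, sub_mul]

theorem form_sum_left {α t : ℝ} (hα : 0 < α) (ht : 0 ≤ t) {n : ℕ} (c : Fin n → ℝ)
    (p : Fin n → ℝ[X]) (s : ℝ[X]) :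
    form α t (∑ k, C (c k) * p k) s = ∑ k, c k * form α t (p k) s := by
  unfold form
  simp only [← intervalIntegral.integral_const_mul]
  rw [← intervalIntegral.integral_finsetSum]
  · congr 1
    ext x
    simp only [eval_finsetSum, eval_mul, eval_C, Finset.sum_mul, mul_assoc]
  · intro k _
    have h1 := (integrable_mul_weight hα ht (p k * s)).const_mul (c k)
    simpa only [eval_mul] using h1

theorem form_self_pos {α t : ℝ} (hα : 0 < α) (ht : 0 ≤ t) {p : ℝ[X]} (hp : p ≠ 0) :
    0 < form α t p p := by
  have hi := integrable_mul_weight hα ht (p * p)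
  simp only [eval_mul] at hi
  unfold form
  have hnn : 0 ≤ᵐ[MeasureTheory.volume.restrict (Set.Ioc (-1 : ℝ) 1)]
      fun x => p.eval x * p.eval x * weight α t x := by
    filter_upwards [MeasureTheory.ae_restrict_mem measurableSet_Ioc] with x hx
    exact mul_nonneg (mul_self_nonneg _) (weight_nonneg α t ⟨hx.1.le, hx.2⟩)
  rw [intervalIntegral.integral_pos_iff_support_of_nonneg_ae' (by
    rw [Set.uIoc_of_le (by norm_num)]; exact hnn) hi]
  refine ⟨by norm_num, ?_⟩
  have hsub : Set.Ioo (-1 : ℝ) 1 \ (p.roots.toFinset : Set ℝ) ⊆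
      Function.support (fun x => p.eval x * p.eval x * weight α t x) ∩ Set.Ioc (-1) 1 := by
    rintro x ⟨hx, hr⟩
    refine ⟨?_, hx.1, hx.2.le⟩
    have hx0 : p.eval x ≠ 0 := by
      intro h0
      exact hr (by simp [hp, IsRoot, h0])
    have hw : 0 < weight α t x :=
      mul_pos (Real.rpow_pos_of_pos (by nlinarith [hx.1, hx.2]) _) (Real.exp_pos _)
    exact mul_ne_zero (mul_ne_zero hx0 hx0) hw.ne'
  refine lt_of_lt_of_le ?_ (MeasureTheory.measure_mono hsub)
  rw [MeasureTheory.measure_sdiff_null (Finset.measure_zero _ _)]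
  simp

/-- `P_n` is monic of degree `n`. -/
theorem P_monic (α t : ℝ) (n : ℕ) : (P α t n).Monic ∧ (P α t n).natDegree = n := by
  induction n using Nat.strong_induction_on with
  | _ n ih =>
    have hdeg : (∑ k : Fin n,
        C (form α t (X ^ n) (P α t k) / form α t (P α t k) (P α t k)) * P α t k).degree
          < (n : WithBot ℕ) := by
      refine lt_of_le_of_lt (degree_sum_le _ _) ((Finset.sup_lt_iff (WithBot.bot_lt_coe n)).2 ?_)
      intro k _
      rw [← smul_eq_C_mul]
      refine lt_of_le_of_lt (degree_smul_le _ _) (lt_of_le_of_lt degree_le_natDegree ?_)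
      rw [(ih k k.2).2]
      exact Nat.cast_lt.2 k.2
    have h1 : (P α t n).Monic := by
      rw [P]; exact monic_X_pow_sub hdeg
    refine ⟨h1, ?_⟩
    rw [P]
    exact natDegree_eq_of_degree_eq_some (by
      rw [degree_sub_eq_left_of_degree_lt (by rwa [degree_X_pow]), degree_X_pow])

/-- The `P_n` are orthogonal for `w(·,t)`. -/
theorem P_orthogonal {α t : ℝ} (hα : 0 < α) (ht : 0 ≤ t) {j k : ℕ} (hjk : j ≠ k) :
    ∫ x in (-1 : ℝ)..1, (P α t j).eval x * (P α t k).eval x * weight α t x = 0 := by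
  change form α t (P α t j) (P α t k) = 0
  have key : ∀ n, ∀ m, m < n → form α t (P α t n) (P α t m) = 0 := by
    intro n
    induction n using Nat.strong_induction_on with
    | _ n ih =>
      intro m hm
      have hpos := form_self_pos hα ht (P_monic α t m).1.ne_zero
      rw [P, form_sub_left hα ht, form_sum_left hα ht, Finset.sum_eq_single ⟨m, hm⟩]
      · rw [div_mul_cancel₀ _ hpos.ne', sub_self]
      · intro k _ hk
        have hkm : (k : ℕ) ≠ m := fun e => hk (Fin.ext e)
        rcases lt_or_gt_of_ne hkm with hlt | hlt
        · rw [form_comm α t (P α t k) (P α t m), ih m hm k hlt, mul_zero]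
        · rw [ih k k.2 m hlt, mul_zero]
      · simp
  rcases lt_or_gt_of_ne hjk with hlt | hlt
  · rw [form_comm]; exact key k j hlt
  · exact key j k hlt

/-- The squared norms are positive. -/
theorem h_pos {α t : ℝ} (hα : 0 < α) (ht : 0 ≤ t) (n : ℕ) : 0 < h α n t := by
  have := form_self_pos hα ht (P_monic α t n).1.ne_zero
  simpa only [h, form, sq] using this

end SingularJacobi

end

/-! The polynomials `P_n(x,t)` are never differentiated in `t`. Put `β = h_{n+1}/h_n` and `K_n =
2n+1+2α+R_n`. Three algebraic relations, valid for every `t > 0`, link consecutive indices: `r_{n+1}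
= R_n - r_n` (`r_succ`), `β R_{n+1} R_n = 2(-1)^n t r_{n+1}` (`R_mul_R`), and `β K_{n+1} K_n =
(n+1+r_{n+1})(n+1+2α+r_{n+1})` (`shifted_R_mul_shifted_R`). The first comes from the three-term
recurrence. The other two come from the poles of `w'/w` at `0` and `±1`: expand one polynomial
factor at the pole; the part that cancels the pole is evaluated by orthogonality, so each integral
becomes a coefficient or value at the pole times an integral linear in the other factor, up to an
`h_n`. Products of such integrals can then be regrouped.

The Riccati system follows by induction on `n` (`HasRiccatiDerivAt.step`). Since `K_{n+1} - R_{n+1}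
= 2n+3+2α` is constant, subtracting the two product relations eliminates `β` and makes `R_{n+1}` and
`r_{n+1}` explicit rational functions of `t`, `R_n` and `r_n`; differentiating these gives the
system at `n+1`. The base case (`hasRiccatiDerivAt_zero`) uses `R_0 = 2t m_2/m_0` with negative
moments `m_k`, where `m_k' = -m_{k+2}` and integration by parts expresses `m_4` through `m_2` and
`m_0`. -/

noncomputable section

namespace SingularJacobi

/-- Orthogonal polynomials for a functional `L` of Pearson type: `M` stands for `L (· / x³)`,
`S` for `L (· / (1 - x²))`, and `ibp` is integration by parts against the weight
`(1 - x²)^α exp(-t/x²)`. -/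
structure IsPearsonSystem (α t : ℝ) (L M S : ℝ[X] →ₗ[ℝ] ℝ) (P : ℕ → ℝ[X]) : Prop where
  pos : ∀ p, p ≠ 0 → 0 < L (p * p)
  S_comp_neg_X : ∀ p, S (p.comp (-X)) = S p
  M_X_pow_mul : ∀ p, M (X ^ 3 * p) = L p
  S_mul : ∀ p, S ((1 - X ^ 2) * p) = L p
  ibp : ∀ p, L (derivative p) - 2 * α * S (X * p) + 2 * t * M p = 0
  monic : ∀ n, (P n).Monic
  natDegree_eq : ∀ n, (P n).natDegree = n
  orthogonal : ∀ j k, j ≠ k → L (P j * P k) = 0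

/-! ### Polynomial division, coefficients and reflection -/

theorem degree_sub_C_coeff_mul_lt {p q : ℝ[X]} {n : ℕ} (hp : p.Monic) (hn : p.natDegree = n)
    (hq : q.degree < (n + 1 : ℕ)) : (q - C (q.coeff n) * p).degree < n := by
  rw [degree_lt_iff_coeff_zero] at hq ⊢
  intro m hm
  rcases hm.eq_or_lt with rfl | hlt
  · have : p.coeff n = 1 := by rw [← hn]; exact hp
    simp [this]
  · have h1 : p.coeff m = 0 := coeff_eq_zero_of_natDegree_lt (by omega)
    simp [h1, hq m hlt]

theorem coeff_comp_neg_X (p : ℝ[X]) (m : ℕ) : (p.comp (-X)).coeff m = (-1) ^ m * p.coeff m := by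
  have h1 : (-X : ℝ[X]) = C (-1) * X := by simp
  rw [h1, comp_C_mul_X_coeff, mul_comm]

theorem exists_eq_C_eval_add {p : ℝ[X]} {n : ℕ} (hn : p.natDegree = n + 1) (a : ℝ) :
    ∃ q : ℝ[X], p = C (p.eval a) + (X - C a) * q ∧ q.degree < (n + 1 : ℕ) ∧
      q.coeff n = p.coeff (n + 1) := by
  have hd : (p /ₘ (X - C a)).degree < (n + 1 : ℕ) := by
    have hp : p ≠ 0 := by rintro rfl; simp at hn
    rw [← hn, ← degree_eq_natDegree hp]
    exact degree_divByMonic_lt _ _ hp (by simp)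
  refine ⟨p /ₘ (X - C a), ?_, hd, ?_⟩
  · rw [X_sub_C_mul_divByMonic_eq_sub_modByMonic, modByMonic_X_sub_C_eq_C_eval]
    ring
  · rw [coeff_divByMonic_X_sub_C_rec, coeff_eq_zero_of_degree_lt hd]
    simp

theorem eq_X_sq_mul_add (p : ℝ[X]) :
    p = C (p.coeff 0) + C (p.coeff 1) * X + X ^ 2 * p.divX.divX := by
  have h0 := p.divX_mul_X_add
  have h1 := p.divX.divX_mul_X_add
  rw [coeff_divX] at h1
  nth_rw 1 [← h0, ← h1]
  ring

theorem degree_divX_lt_natCast {p : ℝ[X]} {n : ℕ} (hp : p.degree < (n + 1 : ℕ)) :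
    p.divX.degree < n := by
  rw [degree_lt_iff_coeff_zero] at hp ⊢
  intro m hm
  rw [coeff_divX]
  exact hp _ (by omega)

/-! ### Orthogonality, parity and the three-term recurrence -/

namespace IsPearsonSystem

variable {α t : ℝ} {L M S : ℝ[X] →ₗ[ℝ] ℝ} {P : ℕ → ℝ[X]} (H : IsPearsonSystem α t L M S P)
include H

theorem degree_lt (n : ℕ) : (P n).degree < (n + 1 : ℕ) := by
  rw [degree_lt_iff_coeff_zero]
  intro m hm
  exact coeff_eq_zero_of_natDegree_lt (by rw [H.natDegree_eq]; omega)

theorem coeff_self (n : ℕ) : (P n).coeff n = 1 := by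
  have := H.monic n
  rwa [Monic, leadingCoeff, H.natDegree_eq] at this

theorem L_mul_eq_zero_of_forall {D : ℝ[X]} {n : ℕ} (hD : ∀ k < n, L (D * P k) = 0) {q : ℝ[X]}
    (hq : q.degree < n) : L (D * q) = 0 := by
  induction n generalizing q with
  | zero =>
    have : q = 0 := by simpa [Nat.WithBot.lt_zero_iff] using hq
    simp [this]
  | succ n ih =>
    have h1 := ih (fun k hk => hD k (by omega))
      (degree_sub_C_coeff_mul_lt (H.monic n) (H.natDegree_eq n) hq)
    have h2 := hD n (by omega)
    have h3 : D * q = D * (q - C (q.coeff n) * P n) + q.coeff n • (D * P n) := by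
      rw [smul_eq_C_mul]; ring
    rw [h3, map_add, map_smul, h1, h2]
    simp

theorem L_P_mul_of_degree_lt {n : ℕ} {q : ℝ[X]} (hq : q.degree < n) : L (P n * q) = 0 :=
  H.L_mul_eq_zero_of_forall (fun k hk => H.orthogonal n k (by omega)) hq

theorem L_P_mul {n : ℕ} {q : ℝ[X]} (hq : q.degree < (n + 1 : ℕ)) :
    L (P n * q) = q.coeff n * L (P n * P n) := by
  have h1 := H.L_P_mul_of_degree_lt
    (degree_sub_C_coeff_mul_lt (H.monic n) (H.natDegree_eq n) hq)
  have h3 : P n * q = P n * (q - C (q.coeff n) * P n) + q.coeff n • (P n * P n) := by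
    rw [smul_eq_C_mul]; ring
  rw [h3, map_add, map_smul, h1, zero_add, smul_eq_mul]

theorem eq_zero_of_orthogonal {D : ℝ[X]} {n : ℕ} (hdeg : D.degree < n)
    (hD : ∀ k < n, L (D * P k) = 0) : D = 0 := by
  by_contra hne
  exact (H.pos D hne).ne' (H.L_mul_eq_zero_of_forall hD hdeg)

/-- The symmetry passes from `S` to `L` because `1 - X ^ 2` is even. -/
theorem L_comp_neg_X (p : ℝ[X]) : L (p.comp (-X)) = L p := by
  rw [← H.S_mul, ← H.S_mul, ← H.S_comp_neg_X ((1 - X ^ 2) * p)]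
  simp

/-- Both sides have the same leading coefficient and are orthogonal to all lower `P k`, so the
difference vanishes by positivity of `L`. -/
theorem P_comp_neg_X (n : ℕ) : (P n).comp (-X) = (-1 : ℝ) ^ n • P n := by
  rw [← sub_eq_zero]
  refine H.eq_zero_of_orthogonal (n := n) ?_ ?_
  · rw [degree_lt_iff_coeff_zero]
    intro m hm
    rcases hm.eq_or_lt with rfl | hlt
    · simp [coeff_comp_neg_X]
    · have : (P n).coeff m = 0 := coeff_eq_zero_of_natDegree_lt (by rw [H.natDegree_eq]; omega)
      simp [coeff_comp_neg_X, this]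
  · intro k hk
    have h1 : L ((P n).comp (-X) * P k) = 0 := by
      rw [← H.L_comp_neg_X]
      have : ((P n).comp (-X) * P k).comp (-X) = P n * (P k).comp (-X) := by
        simp [comp_assoc]
      rw [this]
      apply H.L_P_mul_of_degree_lt
      rw [degree_lt_iff_coeff_zero]
      intro m hm
      have : (P k).coeff m = 0 := coeff_eq_zero_of_natDegree_lt (by rw [H.natDegree_eq]; omega)
      rw [coeff_comp_neg_X, this, mul_zero]
    rw [sub_mul, map_sub, h1, smul_mul_assoc, map_smul, H.orthogonal n k (by omega)]
    simp

theorem coeff_eq_zero {n m : ℕ} (hnm : Odd (n + m)) : (P n).coeff m = 0 := by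
  have h1 := congrArg (fun p => coeff p m) (H.P_comp_neg_X n)
  simp only [coeff_comp_neg_X, coeff_smul, smul_eq_mul] at h1
  rcases Nat.even_or_odd n with hn | hn
  · have hm : Odd m := by
      by_contra hm
      rw [Nat.not_odd_iff_even] at hm
      exact (Nat.not_odd_iff_even.2 (hn.add hm)) hnm
    rw [hn.neg_one_pow, hm.neg_one_pow] at h1
    linarith
  · have hm : Even m := by
      by_contra hm
      rw [Nat.not_even_iff_odd] at hm
      exact (Nat.not_odd_iff_even.2 (hn.add_odd hm)) hnm
    rw [hn.neg_one_pow, hm.neg_one_pow] at h1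
    linarith

theorem S_eq_zero_of_comp {p : ℝ[X]} (hp : p.comp (-X) = -p) : S p = 0 := by
  have h1 := H.S_comp_neg_X p
  rw [hp, map_neg] at h1
  linarith

theorem L_eq_zero_of_comp {p : ℝ[X]} (hp : p.comp (-X) = -p) : L p = 0 := by
  have h1 := H.L_comp_neg_X p
  rw [hp, map_neg] at h1
  linarith

theorem X_mul_P_zero : X * P 0 = P 1 := by
  have h0 : P 0 = 1 := (H.monic 0).natDegree_eq_zero.1 (H.natDegree_eq 0)
  have h1 := eq_X_sq_mul_add (P 1)
  have h2 : (P 1).divX.divX = 0 := by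
    have := degree_divX_lt_natCast (degree_divX_lt_natCast (H.degree_lt 1))
    simpa [Nat.WithBot.lt_zero_iff] using this
  rw [h1, h2, H.coeff_self 1, H.coeff_eq_zero (n := 1) (m := 0) (by decide), h0]
  simp

theorem X_mul_P_succ (n : ℕ) : X * P (n + 1) =
    P (n + 2) + C (L (P (n + 1) * P (n + 1)) / L (P n * P n)) * P n := by
  have hn : L (P n * P n) ≠ 0 := (H.pos _ (H.monic n).ne_zero).ne'
  rw [← sub_eq_zero]
  refine H.eq_zero_of_orthogonal (n := n + 2) ?_ ?_
  · rw [degree_lt_iff_coeff_zero]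
    intro m hm
    obtain ⟨m, rfl⟩ : ∃ j, m = j + 1 := ⟨m - 1, by omega⟩
    have h3 : (P n).coeff (m + 1) = 0 :=
      coeff_eq_zero_of_natDegree_lt (by rw [H.natDegree_eq]; omega)
    rw [coeff_sub, coeff_X_mul, coeff_add, coeff_C_mul, h3]
    rcases hm.eq_or_lt with he | hlt
    · obtain rfl : m = n + 1 := by omega
      simp [H.coeff_self (n + 1), H.coeff_self (n + 2)]
    · have h1 : (P (n + 1)).coeff m = 0 :=
        coeff_eq_zero_of_natDegree_lt (by rw [H.natDegree_eq]; omega)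
      have h2 : (P (n + 2)).coeff (m + 1) = 0 :=
        coeff_eq_zero_of_natDegree_lt (by rw [H.natDegree_eq]; omega)
      simp [h1, h2]
  · intro k hk
    have e : (X * P (n + 1) - (P (n + 2) + C (L (P (n + 1) * P (n + 1)) / L (P n * P n)) * P n))
        * P k = P (n + 1) * (X * P k) - P (n + 2) * P k
          - (L (P (n + 1) * P (n + 1)) / L (P n * P n)) • (P n * P k) := by
      rw [smul_eq_C_mul]; ring
    rw [e, map_sub, map_sub, map_smul, smul_eq_mul, H.orthogonal (n + 2) k (by omega)]
    rcases lt_trichotomy k n with hlt | rfl | hgt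
    · rw [H.orthogonal n k (by omega), H.L_P_mul_of_degree_lt]
      · simp
      · rw [mul_comm, degree_lt_iff_coeff_zero]
        intro m hm
        obtain ⟨m, rfl⟩ : ∃ j, m = j + 1 := ⟨m - 1, by omega⟩
        rw [coeff_mul_X]
        exact coeff_eq_zero_of_natDegree_lt (by rw [H.natDegree_eq]; omega)
    · rw [H.L_P_mul, mul_comm X, coeff_mul_X, H.coeff_self]
      · field_simp
        ring
      · rw [mul_comm, degree_lt_iff_coeff_zero]
        intro m hm
        obtain ⟨m, rfl⟩ : ∃ j, m = j + 1 := ⟨m - 1, by omega⟩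
        rw [coeff_mul_X]
        exact coeff_eq_zero_of_natDegree_lt (by rw [H.natDegree_eq]; omega)
    -- The diagonal term of the recurrence vanishes because `X * P (n + 1) * P (n + 1)` is odd.
    · obtain rfl : k = n + 1 := by omega
      rw [H.orthogonal n (n + 1) (by omega), H.L_eq_zero_of_comp]
      · simp
      · simp only [mul_comp, X_comp, H.P_comp_neg_X, smul_mul_assoc, mul_smul_comm, smul_smul,
          ← mul_pow]
        simp

/-! ### Identities from the singularity at `0` -/

/-- Expand one factor at `0`: beyond the linear term, `X ^ 3` cancels the denominator of `M` and
orthogonality kills the rest. By parity only one of the two terms is nonzero. -/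
theorem M_X_mul_P_mul_P (n : ℕ) : M (X * (P n * P n)) =
    (P n).coeff 0 * M (X * P n) + (P n).coeff 1 * M (X ^ 2 * P n) := by
  have e : X * (P n * P n) = (P n).coeff 0 • (X * P n) + (P n).coeff 1 • (X ^ 2 * P n)
      + X ^ 3 * (P n * (P n).divX.divX) := by
    rw [smul_eq_C_mul, smul_eq_C_mul]
    linear_combination (X * P n) * eq_X_sq_mul_add (P n)
  rw [e, map_add, map_add, map_smul, map_smul, H.M_X_pow_mul, H.L_P_mul_of_degree_lt]
  · simp
  · refine degree_divX_lt_natCast (degree_divX_lt_natCast ((H.degree_lt n).trans_le ?_))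
    exact_mod_cast Nat.le_succ _

theorem eq_of_odd {m : ℕ} (hm : Odd m) :
    P m = C ((P m).coeff 1) * X + X ^ 3 * (P m).divX.divX.divX := by
  have h1 := eq_X_sq_mul_add (P m)
  have h2 := (P m).divX.divX.divX_mul_X_add
  rw [coeff_divX, coeff_divX, H.coeff_eq_zero (hm.add_even (by decide)), C_0] at h2
  rw [H.coeff_eq_zero (n := m) (m := 0) (by simpa using hm), C_0] at h1
  linear_combination h1 - X ^ 2 * h2

theorem degree_divX_divX_divX_lt {m n : ℕ} (hmn : m ≤ n + 2) :
    (P m).divX.divX.divX.degree < n := by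
  refine degree_divX_lt_natCast (degree_divX_lt_natCast (degree_divX_lt_natCast
    ((H.degree_lt m).trans_le ?_)))
  exact_mod_cast Nat.succ_le_succ hmn

theorem M_P_mul_P_of_odd {n m : ℕ} (hm : Odd m) (hmn : m ≤ n + 2) :
    M (P n * P m) = (P m).coeff 1 * M (X * P n) := by
  have e : P n * P m = (P m).coeff 1 • (X * P n) + X ^ 3 * (P n * (P m).divX.divX.divX) := by
    rw [smul_eq_C_mul]
    linear_combination (P n) * H.eq_of_odd hm
  rw [e, map_add, map_smul, H.M_X_pow_mul,
    H.L_P_mul_of_degree_lt (H.degree_divX_divX_divX_lt hmn)]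
  simp

theorem exists_eq_at_zero (m : ℕ) : ∃ q : ℝ[X], P m = C ((P m).coeff 0) + X * q ∧
    q.degree < m ∧ ∀ k, q.coeff k = (P m).coeff (k + 1) :=
  ⟨(P m).divX, by rw [mul_comm X, add_comm, divX_mul_X_add],
    degree_divX_lt_natCast (H.degree_lt m),
    fun _ => coeff_divX⟩

/-- Expanding `P (m + 1)` at `0` leaves a monic quotient of degree `m`, hence the extra norm.
Expanding `P m` instead leaves none; equating the two evaluations gives a Wronskian-type relation.
-/
theorem M_X_sq_mul_P_succ_mul_P_left (m : ℕ) : M (X ^ 2 * (P (m + 1) * P m)) =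
    (P (m + 1)).coeff 0 * M (X ^ 2 * P m) + L (P m * P m) := by
  obtain ⟨q, hq, hd, hc⟩ := H.exists_eq_at_zero (m + 1)
  have e : X ^ 2 * (P (m + 1) * P m) = (P (m + 1)).coeff 0 • (X ^ 2 * P m)
      + X ^ 3 * (P m * q) := by
    rw [smul_eq_C_mul]
    linear_combination (X ^ 2 * P m) * hq
  rw [e, map_add, map_smul, H.M_X_pow_mul, H.L_P_mul hd, hc, H.coeff_self]
  simp

theorem M_X_sq_mul_P_succ_mul_P_right (m : ℕ) : M (X ^ 2 * (P (m + 1) * P m)) =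
    (P m).coeff 0 * M (X ^ 2 * P (m + 1)) := by
  obtain ⟨q, hq, hd, hc⟩ := H.exists_eq_at_zero m
  have e : X ^ 2 * (P (m + 1) * P m) = (P m).coeff 0 • (X ^ 2 * P (m + 1))
      + X ^ 3 * (P (m + 1) * q) := by
    rw [smul_eq_C_mul]
    linear_combination (X ^ 2 * P (m + 1)) * hq
  rw [e, map_add, map_smul, H.M_X_pow_mul, H.L_P_mul_of_degree_lt]
  · simp
  · exact hd.trans_le (by exact_mod_cast Nat.le_succ m)

/-- Each factor on the left is a coefficient at `0` times a linear integral. One coefficient and one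
integral combine to `M (P (m + 1) * P m)` by expanding the odd polynomial; the other pair is `± L (P
m * P m)` by the two evaluations above. The sign records which of the two polynomials is even. -/
theorem M_mul_M (m : ℕ) :
    M (X * (P (m + 1) * P (m + 1))) * M (X * (P m * P m)) =
      (-1) ^ m * L (P m * P m) * M (P (m + 1) * P m) := by
  have h1 := H.M_X_sq_mul_P_succ_mul_P_left m
  rw [H.M_X_sq_mul_P_succ_mul_P_right] at h1
  rw [H.M_X_mul_P_mul_P, H.M_X_mul_P_mul_P]
  rcases Nat.even_or_odd m with hm | hm
  · rw [H.coeff_eq_zero (n := m + 1) (m := 0) (by simpa using hm.add_one)] at h1 ⊢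
    rw [H.coeff_eq_zero (n := m) (m := 1) hm.add_one, mul_comm (P (m + 1)),
      H.M_P_mul_P_of_odd hm.add_one (by omega), hm.neg_one_pow]
    linear_combination (P (m + 1)).coeff 1 * M (X * P m) * h1
  · rw [H.coeff_eq_zero (n := m) (m := 0) (by simpa using hm)] at h1 ⊢
    rw [H.coeff_eq_zero (n := m + 1) (m := 1) (by simpa [Nat.odd_add] using hm),
      H.M_P_mul_P_of_odd hm (by omega), hm.neg_one_pow]
    linear_combination (-(P m).coeff 1) * M (X * P (m + 1)) * h1

/-! ### Identities from the singularity at `1` -/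

/-- As `(1 + x)/(1 - x²) = 1/(1 - x)`, the factor `1 + X` isolates the pole at `1`, which `X - 1`
then cancels up to sign. Parity makes this factor free to insert in the integrals below. -/
theorem S_mul_one_add (p : ℝ[X]) : S ((1 + X) * p * (X - C 1)) = -L p := by
  rw [← H.S_mul, ← map_neg]
  congr 1
  rw [C_1]
  ring

theorem S_P_mul_P (n : ℕ) :
    S (P n * P n) = (P n).eval 1 * S ((1 + X) * P n) := by
  have h1 : S (X * (P n * P n)) = 0 := H.S_eq_zero_of_comp (by
    simp only [mul_comp, X_comp, H.P_comp_neg_X, smul_mul_assoc, mul_smul_comm, smul_smul,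
      ← mul_pow]
    simp)
  have h2 : S ((1 + X) * (P n * P n)) = S (P n * P n) := by
    rw [add_mul, one_mul, map_add, h1, add_zero]
  rw [← h2]
  rcases n with _ | n
  · have h0 : P 0 = 1 := (H.monic 0).natDegree_eq_zero.1 (H.natDegree_eq 0)
    simp [h0]
  · obtain ⟨q, hq, hd, -⟩ := exists_eq_C_eval_add (H.natDegree_eq (n + 1)) 1
    have e : (1 + X) * (P (n + 1) * P (n + 1)) =
        (P (n + 1)).eval 1 • ((1 + X) * P (n + 1)) + (1 + X) * (P (n + 1) * q) * (X - C 1) := by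
      rw [smul_eq_C_mul]
      linear_combination ((1 + X) * P (n + 1)) * hq
    rw [e, map_add, map_smul, H.S_mul_one_add, H.L_P_mul_of_degree_lt hd]
    simp

theorem S_X_mul_P_succ_mul_P (n : ℕ) :
    S (X * (P (n + 1) * P n)) = S ((1 + X) * (P (n + 1) * P n)) := by
  have h1 : S (P (n + 1) * P n) = 0 := H.S_eq_zero_of_comp (by
    simp only [mul_comp, H.P_comp_neg_X, smul_mul_assoc, mul_smul_comm, smul_smul, pow_succ]
    rw [← mul_assoc, ← mul_pow]
    simp)
  rw [add_mul, one_mul, map_add, h1, zero_add]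

theorem S_X_mul_P_succ_mul_P_left (n : ℕ) : S (X * (P (n + 1) * P n)) =
    (P (n + 1)).eval 1 * S ((1 + X) * P n) - L (P n * P n) := by
  rw [H.S_X_mul_P_succ_mul_P]
  obtain ⟨q, hq, hd, hc⟩ := exists_eq_C_eval_add (H.natDegree_eq (n + 1)) 1
  have e : (1 + X) * (P (n + 1) * P n) =
      (P (n + 1)).eval 1 • ((1 + X) * P n) + (1 + X) * (P n * q) * (X - C 1) := by
    rw [smul_eq_C_mul]
    linear_combination ((1 + X) * P n) * hq
  rw [e, map_add, map_smul, H.S_mul_one_add, H.L_P_mul hd, hc, H.coeff_self, smul_eq_mul]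
  ring

theorem S_X_mul_P_succ_mul_P_right (n : ℕ) : S (X * (P (n + 1) * P n)) =
    (P n).eval 1 * S ((1 + X) * P (n + 1)) := by
  rw [H.S_X_mul_P_succ_mul_P]
  rcases n with _ | n
  · have h0 : P 0 = 1 := (H.monic 0).natDegree_eq_zero.1 (H.natDegree_eq 0)
    simp [h0]
  obtain ⟨q, hq, hd, -⟩ := exists_eq_C_eval_add (H.natDegree_eq (n + 1)) 1
  have e : (1 + X) * (P (n + 1 + 1) * P (n + 1)) =
      (P (n + 1)).eval 1 • ((1 + X) * P (n + 1 + 1))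
        + (1 + X) * (P (n + 1 + 1) * q) * (X - C 1) := by
    rw [smul_eq_C_mul]
    linear_combination ((1 + X) * P (n + 1 + 1)) * hq
  rw [e, map_add, map_smul, H.S_mul_one_add, H.L_P_mul_of_degree_lt, smul_eq_mul]
  · ring
  · exact hd.trans_le (by exact_mod_cast Nat.le_succ _)

theorem L_P_mul_X_mul_derivative (n : ℕ) :
    L (P n * (X * derivative (P n))) = n * L (P n * P n) := by
  have hc : ∀ m, (X * derivative (P n)).coeff m = m * (P n).coeff m := by
    intro m
    rcases m with _ | m
    · simp
    · rw [coeff_X_mul, coeff_derivative, mul_comm]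
      push_cast
      ring
  rw [H.L_P_mul, hc, H.coeff_self, mul_one]
  rw [degree_lt_iff_coeff_zero]
  intro m hm
  rw [hc, coeff_eq_zero_of_natDegree_lt (by rw [H.natDegree_eq]; omega), mul_zero]

/-- Integration by parts trades the singularity at `±1` for the one at `0`, turning `S` into the
shifted quantity `2n+1+2α+R_n` up to the norm. -/
theorem two_alpha_mul_S_P_mul_P (n : ℕ) : 2 * α * S (P n * P n) =
    (2 * n + 1 + 2 * α) * L (P n * P n) + 2 * t * M (X * (P n * P n)) := by
  have h1 := H.ibp (X * (P n * P n))
  have h2 : derivative (X * (P n * P n)) = P n * P n + P n * (X * derivative (P n))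
      + P n * (X * derivative (P n)) := by
    simp only [derivative_mul, derivative_X]
    ring
  have h3 : X * (X * (P n * P n)) = P n * P n - (1 - X ^ 2) * (P n * P n) := by ring
  rw [h2, h3, map_add, map_add, H.L_P_mul_X_mul_derivative, map_sub, H.S_mul] at h1
  linear_combination -h1

theorem two_alpha_mul_S_X_mul_P_succ_mul_P (n : ℕ) : 2 * α * S (X * (P (n + 1) * P n)) =
    (n + 1) * L (P n * P n) + 2 * t * M (P (n + 1) * P n) := by
  have h1 := H.ibp (P (n + 1) * P n)
  have h2 : derivative (P (n + 1) * P n) = P n * derivative (P (n + 1))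
      + P (n + 1) * derivative (P n) := by
    simp only [derivative_mul]
    ring
  have h3 : L (P (n + 1) * derivative (P n)) = 0 := by
    apply H.L_P_mul_of_degree_lt
    rw [degree_lt_iff_coeff_zero]
    intro m hm
    rw [coeff_derivative, coeff_eq_zero_of_natDegree_lt (by rw [H.natDegree_eq]; omega), zero_mul]
  have h4 : L (P n * derivative (P (n + 1))) = (n + 1) * L (P n * P n) := by
    rw [H.L_P_mul, coeff_derivative, H.coeff_self, one_mul]
    rw [degree_lt_iff_coeff_zero]
    intro m hm
    rw [coeff_derivative, coeff_eq_zero_of_natDegree_lt (by rw [H.natDegree_eq]; omega), zero_mul]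
  rw [h2, map_add, h3, h4] at h1
  linear_combination -h1

/-- With `a_k = S ((1 + X) * P k)`, both sides equal `(2α)² P_{n+1}(1) a_n P_n(1) a_{n+1}`, grouped
in two ways. The two factors on the left are the two evaluations of `S (X * (P (n + 1) * P n))`,
which differ by the norm. -/
theorem S_identity (n : ℕ) :
    ((n + 1) * L (P n * P n) + 2 * t * M (P (n + 1) * P n)) *
      ((n + 1 + 2 * α) * L (P n * P n) + 2 * t * M (P (n + 1) * P n)) =
    ((2 * n + 3 + 2 * α) * L (P (n + 1) * P (n + 1))
        + 2 * t * M (X * (P (n + 1) * P (n + 1)))) *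
      ((2 * n + 1 + 2 * α) * L (P n * P n) + 2 * t * M (X * (P n * P n))) := by
  have h1 := H.two_alpha_mul_S_P_mul_P n
  have h2 := H.two_alpha_mul_S_P_mul_P (n + 1)
  have h3 := H.two_alpha_mul_S_X_mul_P_succ_mul_P n
  have h4 : (n + 1 + 2 * α) * L (P n * P n) + 2 * t * M (P (n + 1) * P n) =
      2 * α * ((P (n + 1)).eval 1 * S ((1 + X) * P n)) := by
    rw [H.S_X_mul_P_succ_mul_P_left] at h3
    linear_combination -h3
  rw [H.S_X_mul_P_succ_mul_P_right] at h3
  rw [H.S_P_mul_P] at h1 h2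
  push_cast at h2
  have h5 : (2 * n + 3 + 2 * α) * L (P (n + 1) * P (n + 1))
        + 2 * t * M (X * (P (n + 1) * P (n + 1))) =
      2 * α * ((P (n + 1)).eval 1 * S ((1 + X) * P (n + 1))) := by
    linear_combination -h2
  rw [h4, h5, ← h3, ← h1]
  ring

theorem M_X_mul_P_zero : M (X * (P 0 * P 0)) = M (P 1 * P 0) := by
  rw [← H.X_mul_P_zero, mul_assoc]

theorem M_X_mul_P_succ (n : ℕ) : M (X * (P (n + 1) * P (n + 1))) =
    M (P (n + 2) * P (n + 1)) +
      L (P (n + 1) * P (n + 1)) / L (P n * P n) * M (P (n + 1) * P n) := by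
  rw [← mul_assoc, H.X_mul_P_succ, add_mul, map_add, mul_assoc, ← smul_eq_C_mul, map_smul,
    smul_eq_mul, mul_comm (P n) (P (n + 1))]

end IsPearsonSystem

/-! ### Integrability and integration by parts for the weight -/

open MeasureTheory in
theorem integral_congr_off_zero {f g : ℝ → ℝ}
    (hfg : ∀ x ∈ Set.Ioo (-1 : ℝ) 1, x ≠ 0 → f x = g x) :
    ∫ x in (-1 : ℝ)..1, f x = ∫ x in (-1 : ℝ)..1, g x := by
  refine intervalIntegral.integral_congr_ae ?_
  filter_upwards [(Set.toFinite ({0, 1} : Set ℝ)).countable.ae_notMem volume] with x hx hm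
  rw [Set.uIoc_of_le (by norm_num)] at hm
  simp only [Set.mem_insert_iff, Set.mem_singleton_iff, not_or] at hx
  exact hfg x ⟨hm.1, lt_of_le_of_ne hm.2 hx.2⟩ hx.1

open MeasureTheory in
theorem intervalIntegrable_congr_off_zero {f g : ℝ → ℝ}
    (hfg : ∀ x ∈ Set.Ioo (-1 : ℝ) 1, x ≠ 0 → f x = g x)
    (hf : IntervalIntegrable f volume (-1) 1) : IntervalIntegrable g volume (-1) 1 := by
  refine hf.congr_ae ?_
  filter_upwards [ae_restrict_mem measurableSet_uIoc, ae_restrict_of_ae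
    ((Set.toFinite ({0, 1} : Set ℝ)).countable.ae_notMem volume)] with x hm hx
  rw [Set.uIoc_of_le (by norm_num)] at hm
  simp only [Set.mem_insert_iff, Set.mem_singleton_iff, not_or] at hx
  exact hfg x ⟨hm.1, lt_of_le_of_ne hm.2 hx.2⟩ hx.1

theorem measurable_weight (α t : ℝ) : Measurable (weight α t) := by
  unfold weight; fun_prop

/-- From `y ^ k / k! ≤ exp y` at `y = t / x²`; this controls `|x| ^ (2k)`, weakened to `|x| ^ k`
since `|x| ≤ 1`. -/
theorem exp_div_abs_pow_le {t x : ℝ} (ht : 0 < t) (hx : |x| ≤ 1) (k : ℕ) :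
    Real.exp (-t / x ^ 2) / |x| ^ k ≤ k.factorial / t ^ k := by
  have hk : (0 : ℝ) < k.factorial := by exact_mod_cast k.factorial_pos
  rcases eq_or_ne x 0 with rfl | h0
  · rcases k with _ | k
    · simp
    · simp only [abs_zero, ne_eq, Nat.add_eq_zero_iff, one_ne_zero, and_false, not_false_eq_true,
        zero_pow, div_zero]
      positivity
  · have hx0 : 0 < |x| := abs_pos.2 h0
    have h1 := Real.pow_div_factorial_le_exp (t / x ^ 2) (by positivity) k
    rw [neg_div, Real.exp_neg, ← one_div, div_div, div_le_div_iff₀ (by positivity) (by positivity),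
      one_mul]
    rw [div_pow, ← sq_abs, ← pow_mul, div_div, div_le_iff₀ (by positivity)] at h1
    rw [← sq_abs]
    have h2 : |x| ^ (2 * k) ≤ |x| ^ k := pow_le_pow_of_le_one hx0.le hx (by omega)
    calc t ^ k ≤ Real.exp (t / |x| ^ 2) * (|x| ^ (2 * k) * k.factorial) := h1
      _ ≤ Real.exp (t / |x| ^ 2) * (|x| ^ k * k.factorial) := by gcongr
      _ = k.factorial * (Real.exp (t / |x| ^ 2) * |x| ^ k) := by ring

theorem abs_weight_div_pow_le {α t s x : ℝ} (hα : 0 < α) (ht : 0 < t) (hts : t ≤ s)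
    (hx : x ∈ Set.Icc (-1 : ℝ) 1) (k : ℕ) :
    |weight α s x / x ^ k| ≤ k.factorial / t ^ k := by
  have hx1 : |x| ≤ 1 := abs_le.2 hx
  have h1 : (1 - x ^ 2) ^ α ≤ 1 :=
    Real.rpow_le_one (by nlinarith [hx.1, hx.2]) (by nlinarith) hα.le
  have h0 : 0 ≤ (1 - x ^ 2) ^ α := Real.rpow_nonneg (by nlinarith [hx.1, hx.2]) _
  rw [abs_div, abs_of_nonneg (weight_nonneg α s hx), abs_pow, weight, mul_div_assoc]
  calc (1 - x ^ 2) ^ α * (Real.exp (-s / x ^ 2) / |x| ^ k)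
      ≤ 1 * (Real.exp (-t / x ^ 2) / |x| ^ k) := by gcongr
    _ ≤ _ := by rw [one_mul]; exact exp_div_abs_pow_le ht hx1 k

theorem intervalIntegrable_mul_of_abs_le {f g : ℝ → ℝ} {c : ℝ}
    (hf : IntervalIntegrable f MeasureTheory.volume (-1) 1) (hg : Measurable g)
    (hb : ∀ x ∈ Set.Icc (-1 : ℝ) 1, |g x| ≤ c) :
    IntervalIntegrable (fun x => f x * g x) MeasureTheory.volume (-1) 1 := by
  rw [intervalIntegrable_iff_integrableOn_Icc_of_le (by norm_num)] at hf ⊢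
  refine hf.mul_bdd (c := c) hg.aestronglyMeasurable ?_
  filter_upwards [MeasureTheory.ae_restrict_mem measurableSet_Icc] with x hx
  exact hb x hx

theorem intervalIntegrable_weight_div_pow {α t : ℝ} (hα : 0 < α) (ht : 0 < t) (k : ℕ) (p : ℝ[X]) :
    IntervalIntegrable (fun x => p.eval x * weight α t x / x ^ k) MeasureTheory.volume (-1) 1 := by
  simp only [mul_div_assoc]
  exact intervalIntegrable_mul_of_abs_le (p.continuous.intervalIntegrable _ _)
    ((measurable_weight α t).div (by fun_prop))
    (fun x hx => abs_weight_div_pow_le hα ht le_rfl hx k)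

theorem hasDerivAt_one_sub_sq_rpow (α : ℝ) {x : ℝ} (hx : x ∈ Set.Ioo (-1 : ℝ) 1) :
    HasDerivAt (fun y : ℝ => (1 - y ^ 2) ^ α) (-(2 * α) * (x * (1 - x ^ 2) ^ (α - 1))) x := by
  have hx0 : 1 - x ^ 2 ≠ 0 := by nlinarith [hx.1, hx.2]
  have h1 : HasDerivAt (fun y : ℝ => 1 - y ^ 2) (-(2 * x)) x := by
    simpa using (hasDerivAt_pow 2 x).const_sub 1
  convert h1.rpow_const (p := α) (Or.inl hx0) using 1
  ring

/-- For `α < 1` the function is unbounded at `±1`. On each half interval it is, up to a constant,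
the derivative of constant sign of the continuous `(1 - x²)^α`, hence integrable. -/
theorem intervalIntegrable_mul_one_sub_sq_rpow {α : ℝ} (hα : 0 < α) :
    IntervalIntegrable (fun x : ℝ => x * (1 - x ^ 2) ^ (α - 1)) MeasureTheory.volume (-1) 1 := by
  have hc : Continuous (fun y : ℝ => (1 - y ^ 2) ^ α) :=
    (by fun_prop : Continuous (fun y : ℝ => 1 - y ^ 2)).rpow_const (fun _ => Or.inr hα.le)
  have h0 : ∀ x ∈ Set.Ioo (-1 : ℝ) 1, 0 ≤ (1 - x ^ 2) ^ (α - 1) := fun x hx =>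
    Real.rpow_nonneg (by nlinarith [hx.1, hx.2]) _
  have h1 : IntervalIntegrable (fun x : ℝ => -(2 * α) * (x * (1 - x ^ 2) ^ (α - 1)))
      MeasureTheory.volume (-1) 0 := by
    refine intervalIntegral.intervalIntegrable_deriv_of_nonneg hc.continuousOn ?_ ?_ <;>
    · intro x hx
      rw [min_eq_left (by norm_num), max_eq_right (by norm_num)] at hx
      have hx' : x ∈ Set.Ioo (-1 : ℝ) 1 := ⟨hx.1, by linarith [hx.2]⟩
      first
      | exact hasDerivAt_one_sub_sq_rpow α hx'
      | nlinarith [mul_nonneg (mul_nonneg hα.le (h0 x hx')) (by linarith [hx.2] : 0 ≤ -x)]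
  have h2 : IntervalIntegrable (fun x : ℝ => -(-(2 * α) * (x * (1 - x ^ 2) ^ (α - 1))))
      MeasureTheory.volume 0 1 := by
    refine intervalIntegral.intervalIntegrable_deriv_of_nonneg hc.neg.continuousOn ?_ ?_ <;>
    · intro x hx
      rw [min_eq_left (by norm_num), max_eq_right (by norm_num)] at hx
      have hx' : x ∈ Set.Ioo (-1 : ℝ) 1 := ⟨by linarith [hx.1], hx.2⟩
      first
      | exact (hasDerivAt_one_sub_sq_rpow α hx').neg
      | nlinarith [mul_nonneg (mul_nonneg hα.le (h0 x hx')) hx.1.le]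
  have h3 := (h1.trans (h2.neg.congr fun x _ => neg_neg _)).const_mul (-(2 * α))⁻¹
  refine h3.congr (fun x _ => ?_)
  field_simp

theorem intervalIntegrable_weight_div_one_sub_sq {α t : ℝ} (hα : 0 < α) (ht : 0 < t) (p : ℝ[X]) :
    IntervalIntegrable (fun x => p.eval x * weight α t x / (1 - x ^ 2))
      MeasureTheory.volume (-1) 1 := by
  -- The factor `x` in the integrable function is compensated by `exp(-t/x²)/x`, which is still
  -- bounded.
  have h1 := intervalIntegrable_mul_of_abs_le (c := (1 : ℕ).factorial / t ^ 1)
    (g := fun x => Real.exp (-t / x ^ 2) / x)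
    ((intervalIntegrable_mul_one_sub_sq_rpow hα).mul_continuousOn (g := fun x => p.eval x)
      p.continuous.continuousOn) (by fun_prop) (by
      intro x hx
      have := exp_div_abs_pow_le ht (abs_le.2 hx) 1
      rwa [abs_div, Real.abs_exp, ← pow_one |x|])
  refine intervalIntegrable_congr_off_zero (fun x hx h0 => ?_) h1
  have hx0 : 1 - x ^ 2 ≠ 0 := by nlinarith [hx.1, hx.2]
  rw [weight, Real.rpow_sub_one hx0]
  field_simp

/-- The functional `p ↦ ∫ p(x) w(x,t) / x^k dx`. -/
def divPowFunctional {α t : ℝ} (hα : 0 < α) (ht : 0 < t) (k : ℕ) : ℝ[X] →ₗ[ℝ] ℝ where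
  toFun p := ∫ x in (-1 : ℝ)..1, p.eval x * weight α t x / x ^ k
  map_add' p q := by
    rw [← intervalIntegral.integral_add (intervalIntegrable_weight_div_pow hα ht k p)
      (intervalIntegrable_weight_div_pow hα ht k q)]
    simp only [eval_add, add_mul, add_div]
  map_smul' c p := by
    simp only [eval_smul, smul_eq_mul, RingHom.id_apply, mul_assoc, mul_div_assoc,
      intervalIntegral.integral_const_mul]

/-- The functional `p ↦ ∫ p(x) w(x,t) / (1 - x²) dx`. -/
def divOneSubSqFunctional {α t : ℝ} (hα : 0 < α) (ht : 0 < t) : ℝ[X] →ₗ[ℝ] ℝ where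
  toFun p := ∫ x in (-1 : ℝ)..1, p.eval x * weight α t x / (1 - x ^ 2)
  map_add' p q := by
    rw [← intervalIntegral.integral_add (intervalIntegrable_weight_div_one_sub_sq hα ht p)
      (intervalIntegrable_weight_div_one_sub_sq hα ht q)]
    simp only [eval_add, add_mul, add_div]
  map_smul' c p := by
    simp only [eval_smul, smul_eq_mul, RingHom.id_apply, mul_assoc, mul_div_assoc,
      intervalIntegral.integral_const_mul]

theorem divPowFunctional_apply {α t : ℝ} (hα : 0 < α) (ht : 0 < t) (k : ℕ) (p : ℝ[X]) :
    divPowFunctional hα ht k p = ∫ x in (-1 : ℝ)..1, p.eval x * weight α t x / x ^ k := rfl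

theorem divOneSubSqFunctional_apply {α t : ℝ} (hα : 0 < α) (ht : 0 < t) (p : ℝ[X]) :
    divOneSubSqFunctional hα ht p =
      ∫ x in (-1 : ℝ)..1, p.eval x * weight α t x / (1 - x ^ 2) := rfl

theorem divPowFunctional_X_pow_mul {α t : ℝ} (hα : 0 < α) (ht : 0 < t) (k j : ℕ) (p : ℝ[X]) :
    divPowFunctional hα ht (k + j) (X ^ j * p) = divPowFunctional hα ht k p := by
  rw [divPowFunctional_apply, divPowFunctional_apply]
  refine integral_congr_off_zero (fun x _ h0 => ?_)
  simp only [eval_mul, eval_pow, eval_X]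
  field_simp
  ring

theorem divOneSubSqFunctional_mul {α t : ℝ} (hα : 0 < α) (ht : 0 < t) (p : ℝ[X]) :
    divOneSubSqFunctional hα ht ((1 - X ^ 2) * p) = divPowFunctional hα ht 0 p := by
  rw [divPowFunctional_apply, divOneSubSqFunctional_apply]
  refine integral_congr_off_zero (fun x hx h0 => ?_)
  have hx0 : 1 - x ^ 2 ≠ 0 := by nlinarith [hx.1, hx.2]
  simp only [eval_mul, eval_sub, eval_one, eval_pow, eval_X]
  field_simp

theorem divOneSubSqFunctional_comp_neg_X {α t : ℝ} (hα : 0 < α) (ht : 0 < t) (p : ℝ[X]) :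
    divOneSubSqFunctional hα ht (p.comp (-X)) = divOneSubSqFunctional hα ht p := by
  rw [divOneSubSqFunctional_apply, divOneSubSqFunctional_apply]
  have h1 := intervalIntegral.integral_comp_neg (a := -1) (b := 1)
    (fun x : ℝ => p.eval x * weight α t x / (1 - x ^ 2))
  rw [neg_neg] at h1
  rw [← h1]
  congr 1
  ext x
  simp [weight]

theorem hasDerivAt_mul_weight_div (α t : ℝ) (p : ℝ[X]) {x : ℝ} (hx : x ∈ Set.Ioo (-1 : ℝ) 1)
    (h0 : x ≠ 0) :
    HasDerivAt (fun y => p.eval y * weight α t y / y)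
      ((derivative p).eval x * weight α t x / x ^ 1 - p.eval x * weight α t x / x ^ 2
        + 2 * t * (p.eval x * weight α t x / x ^ 4)
        - 2 * α * (p.eval x * weight α t x / (1 - x ^ 2))) x := by
  have hx0 : 1 - x ^ 2 ≠ 0 := by nlinarith [hx.1, hx.2]
  have h1 := hasDerivAt_one_sub_sq_rpow α hx
  have h2 : HasDerivAt (fun y : ℝ => Real.exp (-t / y ^ 2))
      (Real.exp (-t / x ^ 2) * (2 * t / x ^ 3)) x := by
    have h3 : HasDerivAt (fun y : ℝ => -t / y ^ 2) (2 * t / x ^ 3) x := by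
      refine ((hasDerivAt_const x (-t)).div (hasDerivAt_pow 2 x) (by positivity)).congr_deriv ?_
      field_simp
      ring
    exact h3.exp
  have h4 := ((p.hasDerivAt x).mul (h1.mul h2)).div (hasDerivAt_id x) h0
  refine h4.congr_deriv ?_
  simp only [weight, Pi.mul_apply, id_eq, Real.rpow_sub_one hx0]
  field_simp
  ring

theorem continuousOn_mul_weight_div {α t : ℝ} (hα : 0 < α) (ht : 0 < t) (p : ℝ[X]) :
    ContinuousOn (fun y => p.eval y * weight α t y / y) (Set.Icc (-1) 1) := by
  intro x hx
  simp only [mul_div_assoc]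
  refine p.continuous.continuousWithinAt.mul ?_
  rcases eq_or_ne x 0 with rfl | h0
  -- The default value `0` of the quotient at `x = 0` is its actual limit there.
  · rw [ContinuousWithinAt, div_zero]
    refine squeeze_zero_norm' (a := fun y => |y| * ((2 : ℕ).factorial / t ^ 2)) ?_ ?_
    · filter_upwards [self_mem_nhdsWithin] with y hy
      have h1 := abs_weight_div_pow_le hα ht le_rfl hy 2
      rcases eq_or_ne y 0 with rfl | hy0
      · simp
      have h2 : weight α t y / y = y * (weight α t y / y ^ 2) := by field_simp
      rw [h2, Real.norm_eq_abs, abs_mul]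
      gcongr
    · refine tendsto_nhdsWithin_of_tendsto_nhds ?_
      have : Continuous (fun y : ℝ => |y| * (((2 : ℕ).factorial : ℝ) / t ^ 2)) := by fun_prop
      simpa using this.tendsto 0
  · refine ContinuousAt.continuousWithinAt ?_
    refine ContinuousAt.div ?_ continuousAt_id h0
    refine ContinuousAt.mul ?_ ?_
    · exact ((by fun_prop : Continuous (fun y : ℝ => 1 - y ^ 2)).rpow_const
        (fun _ => Or.inr hα.le)).continuousAt
    · refine ContinuousAt.rexp (continuousAt_const.div (by fun_prop) (by positivity))

theorem integral_by_parts {α t : ℝ} (hα : 0 < α) (ht : 0 < t) (p : ℝ[X]) :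
    divPowFunctional hα ht 1 (derivative p) - divPowFunctional hα ht 2 p
      + 2 * t * divPowFunctional hα ht 4 p - 2 * α * divOneSubSqFunctional hα ht p = 0 := by
  have i1 := intervalIntegrable_weight_div_pow hα ht 1 (derivative p)
  have i2 := intervalIntegrable_weight_div_pow hα ht 2 p
  have i3 := (intervalIntegrable_weight_div_pow hα ht 4 p).const_mul (2 * t)
  have i4 := (intervalIntegrable_weight_div_one_sub_sq hα ht p).const_mul (2 * α)
  have key := MeasureTheory.integral_eq_of_hasDerivAt_off_countable_of_le
    _ _ (by norm_num : (-1 : ℝ) ≤ 1) (Set.countable_singleton (0 : ℝ))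
    (continuousOn_mul_weight_div hα ht p)
    (fun x hx => hasDerivAt_mul_weight_div α t p hx.1 hx.2) (((i1.sub i2).add i3).sub i4)
  rw [intervalIntegral.integral_sub ((i1.sub i2).add i3) i4,
    intervalIntegral.integral_add (i1.sub i2) i3, intervalIntegral.integral_sub i1 i2,
    intervalIntegral.integral_const_mul, intervalIntegral.integral_const_mul] at key
  simp only [divPowFunctional_apply, divOneSubSqFunctional_apply]
  rw [key]
  -- The boundary terms vanish because `(1 - x²)^α` is zero at `±1` for `α > 0`.
  simp [weight, Real.zero_rpow hα.ne']

theorem isPearsonSystem {α t : ℝ} (hα : 0 < α) (ht : 0 < t) :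
    IsPearsonSystem α t (divPowFunctional hα ht 0) (divPowFunctional hα ht 3)
      (divOneSubSqFunctional hα ht) (P α t) where
  pos p hp := by
    have := form_self_pos hα ht.le hp
    simpa only [divPowFunctional_apply, form, eval_mul, pow_zero, div_one] using this
  S_comp_neg_X := divOneSubSqFunctional_comp_neg_X hα ht
  M_X_pow_mul p := divPowFunctional_X_pow_mul hα ht 0 3 p
  S_mul := divOneSubSqFunctional_mul hα ht
  ibp p := by
    have h1 := integral_by_parts hα ht (X * p)
    have h2 := divPowFunctional_X_pow_mul hα ht 0 1 (derivative p)
    have h3 := divPowFunctional_X_pow_mul hα ht 1 1 p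
    have h4 := divPowFunctional_X_pow_mul hα ht 3 1 p
    simp only [pow_one, Nat.reduceAdd] at h2 h3 h4
    rw [derivative_mul, derivative_X, one_mul, map_add, h2, h3, h4] at h1
    linear_combination h1
  monic n := (P_monic α t n).1
  natDegree_eq n := (P_monic α t n).2
  orthogonal j k hjk := by
    have := P_orthogonal hα ht.le hjk
    simpa only [divPowFunctional_apply, eval_mul, pow_zero, div_one] using this

/-! ### Negative moments, for the base case -/

/-- The negative moments `∫ w(x,t) / x^k dx`. -/
def negMoment (α : ℝ) (k : ℕ) (t : ℝ) : ℝ := ∫ x in (-1 : ℝ)..1, weight α t x / x ^ k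

theorem hasDerivAt_negMoment {α t : ℝ} (hα : 0 < α) (ht : 0 < t) (k : ℕ) :
    HasDerivAt (negMoment α k) (-negMoment α (k + 2) t) t := by
  have hi := fun k => intervalIntegrable_weight_div_pow hα ht k 1
  simp only [eval_one, one_mul] at hi
  have key := intervalIntegral.hasDerivAt_integral_of_dominated_loc_of_deriv_le
    (F := fun s x => weight α s x / x ^ k) (F' := fun s x => -(weight α s x / x ^ (k + 2)))
    (μ := MeasureTheory.volume) (a := -1) (b := 1) (x₀ := t)
    -- Staying above `t / 2` gives one bound on the differentiated integrand, uniform in `s`.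
    (s := Set.Ioi (t / 2)) (bound := fun _ => (k + 2).factorial / (t / 2) ^ (k + 2))
    (Ioi_mem_nhds (by linarith))
    (Filter.Eventually.of_forall fun s =>
      ((measurable_weight α s).div (by fun_prop)).aestronglyMeasurable) (hi k)
    ((measurable_weight α t).div (by fun_prop)).neg.aestronglyMeasurable
    (Filter.Eventually.of_forall fun x hx s hs => by
      rw [Set.uIoc_of_le (by norm_num)] at hx
      rw [norm_neg]
      exact abs_weight_div_pow_le hα (by linarith) (le_of_lt hs) ⟨hx.1.le, hx.2⟩ (k + 2))
    (by simp)
    (by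
      filter_upwards [(Set.countable_singleton (0 : ℝ)).ae_notMem MeasureTheory.volume]
        with x hx _ s _
      have hx0 : x ≠ 0 := hx
      have h1 : HasDerivAt (fun s : ℝ => -s / x ^ 2) (-1 / x ^ 2) s :=
        (hasDerivAt_id s).neg.div_const _
      refine ((h1.exp.const_mul ((1 - x ^ 2) ^ α)).div_const (x ^ k)).congr_deriv ?_
      unfold weight
      field_simp
      ring)
  refine key.2.congr_deriv ?_
  simp [negMoment]

theorem negMoment_recurrence {α t : ℝ} (hα : 0 < α) (ht : 0 < t) :
    2 * t * negMoment α 4 t = (1 + 2 * t) * negMoment α 2 t + (1 + 2 * α) * negMoment α 0 t := by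
  -- The choice `1 - X ^ 2` cancels the pole at `±1`, so only negative moments remain.
  have h1 := integral_by_parts hα ht (1 - X ^ 2)
  have hm : ∀ k, negMoment α k t = divPowFunctional hα ht k 1 := fun k => by
    simp [negMoment, divPowFunctional_apply]
  have h2 := divPowFunctional_X_pow_mul hα ht 0 1 1
  have h3 := divPowFunctional_X_pow_mul hα ht 0 2 1
  have h4 := divPowFunctional_X_pow_mul hα ht 2 2 1
  have h5 := divOneSubSqFunctional_mul hα ht 1
  have h6 : derivative (1 - X ^ 2 : ℝ[X]) = -((2 : ℝ) • X) := by
    rw [smul_eq_C_mul]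
    simp [C_ofNat, one_add_one_eq_two]
  simp only [pow_one, Nat.reduceAdd, mul_one] at h2 h3 h4 h5
  rw [h6, map_neg, map_smul, map_sub, map_sub, h2, h3, h4, h5, smul_eq_mul] at h1
  rw [hm, hm, hm]
  linear_combination h1

/-! ### Algebraic relations between `R_n` and `r_n` -/

theorem h_eq {α t : ℝ} (hα : 0 < α) (ht : 0 < t) (n : ℕ) :
    h α n t = divPowFunctional hα ht 0 (P α t n * P α t n) := by
  simp [h, divPowFunctional_apply, sq]

theorem R_eq {α t : ℝ} (hα : 0 < α) (ht : 0 < t) (n : ℕ) :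
    R α n t = 2 * t / h α n t * divPowFunctional hα ht 3 (X * (P α t n * P α t n)) := by
  have h1 := divPowFunctional_X_pow_mul hα ht 2 1 (P α t n * P α t n)
  simp only [pow_one, Nat.reduceAdd] at h1
  rw [h1]
  simp [R, divPowFunctional_apply, sq]

theorem r_succ_eq {α t : ℝ} (hα : 0 < α) (ht : 0 < t) (n : ℕ) :
    r α (n + 1) t =
      2 * t / h α n t * divPowFunctional hα ht 3 (P α t (n + 1) * P α t n) := by
  simp [r, divPowFunctional_apply]

/-- Since `1 / y² ≥ 1` on the interval, the integral dominates `h_n`; in fact `R_n ≥ 2t`. -/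
theorem R_pos {α t : ℝ} (hα : 0 < α) (ht : 0 < t) (n : ℕ) : 0 < R α n t := by
  have h1 : h α n t ≤ ∫ y in (-1 : ℝ)..1, (P α t n).eval y ^ 2 * weight α t y / y ^ 2 := by
    have i0 := intervalIntegrable_weight_div_pow hα ht 0 (P α t n * P α t n)
    have i2 := intervalIntegrable_weight_div_pow hα ht 2 (P α t n * P α t n)
    simp only [← sq, eval_pow, pow_zero, div_one] at i0 i2
    refine intervalIntegral.integral_mono_ae_restrict (by norm_num) i0 i2 ?_
    filter_upwards [MeasureTheory.ae_restrict_mem measurableSet_Icc, MeasureTheory.ae_restrict_of_ae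
      ((Set.countable_singleton (0 : ℝ)).ae_notMem MeasureTheory.volume)] with x hx hx0
    have hx0' : x ≠ 0 := hx0
    rw [le_div_iff₀ (by positivity)]
    exact mul_le_of_le_one_right (mul_nonneg (sq_nonneg _) (weight_nonneg α t hx))
      (by nlinarith [hx.1, hx.2])
  have h2 := h_pos hα ht.le n
  rw [R]
  exact mul_pos (by positivity) (h2.trans_le h1)

theorem r_one {α t : ℝ} (hα : 0 < α) (ht : 0 < t) : r α 1 t = R α 0 t := by
  rw [r_succ_eq hα ht, R_eq hα ht, (isPearsonSystem hα ht).M_X_mul_P_zero]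

theorem r_succ {α t : ℝ} (hα : 0 < α) (ht : 0 < t) (n : ℕ) :
    r α (n + 1) t = R α n t - r α n t := by
  rcases n with _ | n
  · rw [r_one hα ht]
    simp [r]
  · have h0 := (h_pos hα ht.le n).ne'
    have h1 := (h_pos hα ht.le (n + 1)).ne'
    rw [R_eq hα ht, r_succ_eq hα ht, r_succ_eq hα ht, (isPearsonSystem hα ht).M_X_mul_P_succ,
      ← h_eq hα ht, ← h_eq hα ht]
    field_simp
    ring

theorem R_mul_R {α t : ℝ} (hα : 0 < α) (ht : 0 < t) (n : ℕ) :
    h α (n + 1) t / h α n t * R α (n + 1) t * R α n t =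
      2 * (-1) ^ n * t * r α (n + 1) t := by
  have h0 := (h_pos hα ht.le n).ne'
  have h1 := (h_pos hα ht.le (n + 1)).ne'
  have h2 := (isPearsonSystem hα ht).M_mul_M n
  rw [← h_eq hα ht] at h2
  rw [R_eq hα ht, R_eq hα ht, r_succ_eq hα ht]
  field_simp
  linear_combination h2

theorem shifted_R_mul_shifted_R {α t : ℝ} (hα : 0 < α) (ht : 0 < t) (n : ℕ) :
    h α (n + 1) t / h α n t * (2 * n + 3 + 2 * α + R α (n + 1) t) *
        (2 * n + 1 + 2 * α + R α n t) =
      (n + 1 + r α (n + 1) t) * (n + 1 + 2 * α + r α (n + 1) t) := by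
  have h0 := (h_pos hα ht.le n).ne'
  have h1 := (h_pos hα ht.le (n + 1)).ne'
  have h2 := (isPearsonSystem hα ht).S_identity n
  rw [← h_eq hα ht, ← h_eq hα ht] at h2
  rw [R_eq hα ht, R_eq hα ht, r_succ_eq hα ht]
  field_simp
  linear_combination -h2

/-! ### Induction for the Riccati system -/

/-- The pair `(R, r)` satisfies the coupled Riccati equations with index `n` and sign `s` at
`t`. -/
def HasRiccatiDerivAt (α n s : ℝ) (R r : ℝ → ℝ) (t : ℝ) : Prop :=
  HasDerivAt r ((-(2 * s * t * r t * (2 * n + 1 + 2 * α + R t)) / R t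
      - ((n + r t) * (n + 2 * α + r t) * R t) / (2 * n + 1 + 2 * α + R t)) / (2 * t)) t ∧
  HasDerivAt R ((R t ^ 2 + (1 - 2 * s * t - 2 * r t) * R t
      - 2 * s * (2 * n + 2 * α + 1) * t) / (2 * t)) t

/-- No regularity of `β` or `R'` is assumed: both are eliminated in favour of `R` and `r'`. Write
`K` and `K'` for the shifted `R` and `R'`, `X = β K'` and `Y = β R'`. -/
theorem HasRiccatiDerivAt.step {α n s t : ℝ} {R r R' r' β : ℝ → ℝ} (hα : 0 < α) (hn : 0 ≤ n)
    (hH : HasRiccatiDerivAt α n s R r t) (ht : 0 < t) (hR : ∀ τ > 0, 0 < R τ)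
    (hR' : ∀ τ > 0, 0 < R' τ) (hβ : ∀ τ > 0, 0 < β τ) (hr : ∀ τ > 0, r' τ = R τ - r τ)
    (hRR : ∀ τ > 0, β τ * R' τ * R τ = 2 * s * τ * r' τ)
    (hKK : ∀ τ > 0, β τ * (2 * n + 3 + 2 * α + R' τ) * (2 * n + 1 + 2 * α + R τ) =
      (n + 1 + r' τ) * (n + 1 + 2 * α + r' τ)) :
    HasRiccatiDerivAt α (n + 1) (-s) R' r' t := by
  obtain ⟨hdr, hdR⟩ := hH
  have hK : 0 < 2 * n + 1 + 2 * α + R t := by linarith [hR t ht]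
  have hK' : 0 < 2 * n + 3 + 2 * α + R' t := by linarith [hR' t ht]
  have hR0 := (hR t ht).ne'
  have hR0' := (hR' t ht).ne'
  have hβ0 := (hβ t ht).ne'
  have hev : ∀ᶠ τ in nhds t, 0 < τ := lt_mem_nhds ht
  have hdr' : HasDerivAt r' ((β t * (2 * n + 3 + 2 * α + R' t) * R t
      - β t * R' t * (2 * n + 1 + 2 * α + R t)) / (2 * t)) t := by
    refine ((hdR.sub hdr).congr_of_eventuallyEq
      (hev.mono fun τ hτ => hr τ hτ)).congr_deriv ?_
    -- Since `r = R - r'`, one has `n + r = K - (n + 1 + 2α + r')` and `n + 2α + r = K - (n + 1 +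
    -- r')`, so the quotients in the equation for `r` reduce to `X` and `Y`.
    have hX : β t * (2 * n + 3 + 2 * α + R' t) = (n + 1 + r' t) * (n + 1 + 2 * α + r' t) /
        (2 * n + 1 + 2 * α + R t) := by rw [eq_div_iff hK.ne', hKK t ht]
    have hY : β t * R' t = 2 * s * t * r' t / R t := by rw [eq_div_iff hR0, hRR t ht]
    rw [hX, hY, hr t ht]
    field_simp
    ring
  -- `X` and `Y` are expressed through `R` and `r'` alone, whose derivatives are known, so both can
  -- be differentiated.
  have hX : ∀ τ > 0, (n + 1 + r' τ) * (n + 1 + 2 * α + r' τ) / (2 * n + 1 + 2 * α + R τ) =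
      β τ * (2 * n + 3 + 2 * α + R' τ) := fun τ hτ => by
    have : 0 < 2 * n + 1 + 2 * α + R τ := by linarith [hR τ hτ]
    rw [div_eq_iff this.ne', hKK τ hτ]
  have hY : ∀ τ > 0, 2 * s * τ * r' τ / R τ = β τ * R' τ := fun τ hτ => by
    rw [div_eq_iff (hR τ hτ).ne', hRR τ hτ]
  have hdR2 : HasDerivAt R ((R t * (1 + 2 * r' t - R t)
      - 2 * s * t * (2 * n + 1 + 2 * α + R t)) / (2 * t)) t := by
    refine hdR.congr_deriv ?_
    rw [hr t ht]
    ring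
  have hdX : HasDerivAt
      (fun τ => (n + 1 + r' τ) * (n + 1 + 2 * α + r' τ) / (2 * n + 1 + 2 * α + R τ))
      ((β t * (2 * n + 3 + 2 * α + R' t) * R t - (2 * n + 2 + 2 * α + 2 * r' t) * (β t * R' t)
        + 2 * s * t * (β t * (2 * n + 3 + 2 * α + R' t))) / (2 * t)) t := by
    refine (((hdr'.const_add (n + 1)).mul (hdr'.const_add (n + 1 + 2 * α))).div
      (hdR2.const_add (2 * n + 1 + 2 * α)) hK.ne').congr_deriv ?_
    simp only [Pi.mul_apply]
    rw [← hKK t ht]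
    field_simp
    ring
  have hdY : HasDerivAt (fun τ => 2 * s * τ * r' τ / R τ)
      ((2 * (β t * R' t) + 2 * s * t * (β t * (2 * n + 3 + 2 * α + R' t))
        - β t * R' t * (1 + 2 * r' t - R t)) / (2 * t)) t := by
    refine (((((hasDerivAt_id t).const_mul (2 * s)).mul hdr')).div hdR2 hR0).congr_deriv ?_
    simp only [Pi.mul_apply, id_eq]
    have h1 : 2 * s * r' t = β t * R' t * R t / t := by
      rw [eq_div_iff ht.ne', hRR t ht]
      ring
    rw [mul_one, mul_right_comm (2 * s) t (r' t), h1]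
    field_simp
    ring
  have hXY : β t * (2 * n + 3 + 2 * α + R' t) - β t * R' t = β t * (2 * n + 3 + 2 * α) := by ring
  have hK2 : 0 < 2 * n + 3 + 2 * α := by linarith
  constructor
  · refine hdr'.congr_deriv ?_
    have h2 := hRR t ht
    have h3 := hKK t ht
    have h4 : -(2 * -s * t * r' t * (2 * (n + 1) + 1 + 2 * α + R' t)) / R' t =
        β t * (2 * n + 3 + 2 * α + R' t) * R t := by
      rw [div_eq_iff hR0']
      linear_combination (-(2 * n + 3 + 2 * α + R' t)) * h2
    have h5 : (n + 1 + r' t) * (n + 1 + 2 * α + r' t) * R' t / (2 * (n + 1) + 1 + 2 * α + R' t) =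
        β t * R' t * (2 * n + 1 + 2 * α + R t) := by
      rw [div_eq_iff (by linarith)]
      linear_combination (-R' t) * h3
    rw [h4, h5]
  -- As `X - Y = β (2n+3+2α)`, near `t` one has `R' = Y (2n+3+2α) / (X - Y)`; the quotient rule
  -- applies since `X - Y > 0`.
  · refine (((hdY.mul_const (2 * n + 3 + 2 * α)).div (hdX.sub hdY) ?_).congr_of_eventuallyEq
      (hev.mono fun τ hτ => ?_)).congr_deriv ?_
    · simp only [Pi.sub_apply]
      rw [hX t ht, hY t ht, hXY]
      positivity
    · simp only [Pi.div_apply, Pi.sub_apply]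
      rw [hX τ hτ, hY τ hτ]
      have := (hβ τ hτ).ne'
      rw [eq_div_iff (by
        rw [← mul_sub, add_sub_cancel_right]
        positivity)]
      ring
    · simp only [Pi.sub_apply]
      rw [hX t ht, hY t ht, hXY]
      field_simp
      ring

theorem hasRiccatiDerivAt_zero {α t : ℝ} (hα : 0 < α) (ht : 0 < t) :
    HasRiccatiDerivAt α 0 1 (R α 0) (r α 0) t := by
  have hP : ∀ τ, P α τ 0 = 1 := fun τ => by rw [P]; simp
  have hR : ∀ τ, R α 0 τ = 2 * τ * negMoment α 2 τ / negMoment α 0 τ := fun τ => by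
    simp only [R, h, hP, negMoment, eval_one, one_pow, one_mul, pow_zero, div_one]
    ring
  have hr : r α 0 = fun _ => 0 := rfl
  have h0 : negMoment α 0 t ≠ 0 := by
    have := (h_pos hα ht.le 0).ne'
    simpa [h, hP, negMoment] using this
  have hrec := negMoment_recurrence hα ht
  constructor
  · rw [hr]
    exact (hasDerivAt_const t 0).congr_deriv (by simp)
  · rw [show R α 0 = _ from funext hR]
    refine ((((hasDerivAt_id t).const_mul 2).mul (hasDerivAt_negMoment hα ht 2)).div
      (hasDerivAt_negMoment hα ht 0) h0).congr_deriv ?_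
    have h4 : negMoment α 4 t = ((1 + 2 * t) * negMoment α 2 t
        + (1 + 2 * α) * negMoment α 0 t) / (2 * t) := by
      rw [← hrec]
      field_simp
    simp only [hr, Pi.mul_apply, id_eq, Nat.reduceAdd, h4]
    field_simp
    ring

theorem hasRiccatiDerivAt {α : ℝ} (hα : 0 < α) (n : ℕ) {t : ℝ} (ht : 0 < t) :
    HasRiccatiDerivAt α n ((-1) ^ n) (R α n) (r α n) t := by
  induction n with
  | zero => simpa using hasRiccatiDerivAt_zero hα ht
  | succ n ih =>
    rw [pow_succ, mul_neg_one, Nat.cast_succ]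
    exact ih.step hα n.cast_nonneg ht (fun τ hτ => R_pos hα hτ n)
      (fun τ hτ => R_pos hα hτ (n + 1))
      (fun τ hτ => div_pos (h_pos hα hτ.le (n + 1)) (h_pos hα hτ.le n))
      (fun τ hτ => r_succ hα hτ n) (fun τ hτ => R_mul_R hα hτ n)
      (fun τ hτ => shifted_R_mul_shifted_R hα hτ n)

end SingularJacobi

end

theorem proposition3p1 (α : ℝ) (hα : 0 < α) (n : ℕ) (t : ℝ) (ht : 0 < t) :
    SingularJacobi.R α n t ≠ 0 ∧
    2 * (n : ℝ) + 1 + 2 * α + SingularJacobi.R α n t ≠ 0 ∧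
    DifferentiableAt ℝ (fun s : ℝ => SingularJacobi.r α n s) t ∧
    DifferentiableAt ℝ (fun s : ℝ => SingularJacobi.R α n s) t ∧
    2 * t * deriv (fun s : ℝ => SingularJacobi.r α n s) t =
      -(2 * (-1 : ℝ) ^ n * t * SingularJacobi.r α n t *
          (2 * (n : ℝ) + 1 + 2 * α + SingularJacobi.R α n t)) / SingularJacobi.R α n t
      - (((n : ℝ) + SingularJacobi.r α n t) * ((n : ℝ) + 2 * α + SingularJacobi.r α n t) *
          SingularJacobi.R α n t) / (2 * (n : ℝ) + 1 + 2 * α + SingularJacobi.R α n t) ∧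
    2 * t * deriv (fun s : ℝ => SingularJacobi.R α n s) t =
      SingularJacobi.R α n t ^ 2
      + (1 - 2 * (-1 : ℝ) ^ n * t - 2 * SingularJacobi.r α n t) * SingularJacobi.R α n t
      - 2 * (-1 : ℝ) ^ n * (2 * (n : ℝ) + 2 * α + 1) * t := by
  have hR := SingularJacobi.R_pos hα ht n
  obtain ⟨hr', hR'⟩ := SingularJacobi.hasRiccatiDerivAt hα n ht
  refine ⟨hR.ne', by positivity, hr'.differentiableAt, hR'.differentiableAt, ?_, ?_⟩
  · rw [hr'.deriv]
    exact mul_div_cancel₀ _ (by positivity)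
  · rw [hR'.deriv]
    exact mul_div_cancel₀ _ (by positivity)
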